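/- There exist absolute constants $c_0,c_1,c_2>0$ for which the following holds. Let $(\mathcal X,\mu)$ be a probability space, let $X$ be a random variable distributed according to $\mu$, and let $Y$ be a real-valued random variable with $\mathbb E Y^2<\infty$. Let $F=\{f_1,\dots,f_M\}$ be a finite family of functions in $L_2(\mu)$, let ${\rm span}(F)$ be its linear span, put $\|f\|_{L_p}=(\mathbb E|f(X)|^p)^{1/p}$ and $R(f)=\mathbb E(Y-f(X))^2$, and let $f^*\in{\rm span}(F)$ satisfy $R(f^*)=\min_{f\in{\rm span}(F)}R(f)$. Assume that $\theta_0>0$ is such that $$\|f\|_{L_4}\le\theta_0\|f\|_{L_2}\qquad\text{for every } f\in{\rm span}(F).$$ Set $\zeta=Y-f^*(X)$, assume that $\mathbb E\zeta^4<\infty$ and put $\sigma=(\mathbb E\zeta^4)^{1/4}$ ($\zeta$ may depend on $X$ and need not be bounded). Let $N\ge1$ be an integer with $N\ge(c_0\theta_0^4)^2M$, let $(X_i,Y_i)_{i=1}^N$ be independent copies of $(X,Y)$, and let $\hat f$ be any empirical risk minimizer, that is, $$\hat f\in\mathop{\rm argmin}_{f\in{\rm span}(F)}\frac1N\sum_{i=1}^N\big(Y_i-f(X_i)\big)^2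 .$$ Then, for every $x>0$, with probability at least $1-\exp\big(-N/(c_1\theta_0^8)\big)-1/x$, $$\|\hat f-f^*\|_{L_2}^2=R(\hat f)-\min_{f\in{\rm span}(F)}R(f)\le c_2\theta_0^{12}\,\frac{\sigma^2Mx}{N}.$$ Here $R(\hat f)=\mathbb E\big((Y-\hat f(X))^2\mid (X_i,Y_i)_{i=1}^N\big)$, where $(X,Y)$ is independent of the sample, is the risk of the function selected from the sample; likewise $\|\hat f-f^*\|_{L_2}$ is computed with the sample held fixed. -/

import Mathlib

open MeasureTheory ProbabilityTheory

namespace LinearAggregation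

/-- The linear span of the dictionary `F = {f₁, …, f_M}`, as a space of functions on `𝒳`. -/
def dictSpan {𝒳 : Type*} {M : ℕ} (F : Fin M → 𝒳 → ℝ) : Submodule ℝ (𝒳 → ℝ) :=
  Submodule.span ℝ (Set.range F)

/-- The squared risk `R(f) = 𝔼 (Y - f(X))²`. The risk `R(f̂)` of a data-dependent function `f̂` is
its value at the realised function, that is, the conditional expectation given the sample. -/
noncomputable def risk {Ω₀ 𝒳 : Type*} [MeasurableSpace Ω₀] (P₀ : Measure Ω₀)
    (X : Ω₀ → 𝒳) (Y : Ω₀ → ℝ) (f : 𝒳 → ℝ) : ℝ :=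
  ∫ ω, (Y ω - f (X ω)) ^ 2 ∂P₀

/-- The empirical risk `R_N(f) = (1/N) ∑ᵢ (yᵢ - f(xᵢ))²` on the data points `(xᵢ, yᵢ)`. -/
noncomputable def empiricalRisk {𝒳 : Type*} {N : ℕ} (x : Fin N → 𝒳) (y : Fin N → ℝ)
    (f : 𝒳 → ℝ) : ℝ :=
  (1 / (N : ℝ)) * ∑ i, (y i - f (x i)) ^ 2

/-- `f` is an oracle: it lies in `span(F)` and minimises the risk there. -/
def IsOracle {Ω₀ 𝒳 : Type*} [MeasurableSpace Ω₀] (P₀ : Measure Ω₀)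
    (X : Ω₀ → 𝒳) (Y : Ω₀ → ℝ) {M : ℕ} (F : Fin M → 𝒳 → ℝ) (f : 𝒳 → ℝ) : Prop :=
  f ∈ dictSpan F ∧ ∀ g ∈ dictSpan F, risk P₀ X Y f ≤ risk P₀ X Y g

/-- `f` is an empirical risk minimiser: it lies in `span(F)` and minimises the empirical risk
there. -/
def IsERM {𝒳 : Type*} {N M : ℕ} (x : Fin N → 𝒳) (y : Fin N → ℝ) (F : Fin M → 𝒳 → ℝ)
    (f : 𝒳 → ℝ) : Prop :=
  f ∈ dictSpan F ∧ ∀ g ∈ dictSpan F, empiricalRisk x y f ≤ empiricalRisk x y g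

end LinearAggregation

namespace LinearAggregation

/-! Fix an orthonormal basis of the span in `L₂(μ)`, let `E(X)` be the vector of its values and `t`
the coordinates of `f̂ - f*`. Comparing the empirical risks of `f̂` and `f*` gives `∑ᵢ (t·E(Xᵢ))² ≤
2 t·Z` with `Z = ∑ᵢ ζᵢ E(Xᵢ)`. Once the left side is at least `(N/8)|t|²`, Cauchy–Schwarz yields
`|t|² ≤ 256 |Z|²/N²`.

Noise: the summands of `Z` are centred because the oracle residual is orthogonal to the span, and
fourth moments give `𝔼|Z|² ≤ N d σ² θ²`; Markov's inequality costs the probability `1/x`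
(`measure_sum_sq_gt_le`).

Quadratic form (`measure_exists_quadratic_lt_le`): a sum of nonnegative variables has a good lower
tail under two moments only, so a fixed vector fails with exponentially small probability.
Uniformity comes from a union bound over lattice points. A vector is rounded to the lattice
coordinate by coordinate, as if by unbiased random rounding, so the form grows by at most `mesh²/4`
times its trace, and no bound on the largest eigenvalue is needed. Truncating the sample vectors
bounds that trace and only lowers the form. The number of lattice points, `exp(O(θ⁴ d))`, is
absorbed by `N ≥ 10000 θ⁸ d`. -/

/-! ### Counting lattice points and rounding to a lattice. -/

lemma exp_neg_le_quadratic {z : ℝ} (hz : 0 ≤ z) : Real.exp (-z) ≤ 1 - z + z ^ 2 / 2 := by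
  have h1 := Real.quadratic_le_exp_of_nonneg hz
  have h2 : Real.exp (-z) * Real.exp z = 1 := by rw [← Real.exp_add]; simp
  have h3 := Real.exp_pos (-z)
  have h4 : 0 ≤ 1 - z + z ^ 2 / 2 := by nlinarith [sq_nonneg (z - 1)]
  -- The product equals `1 + z ^ 4 / 4`.
  have h5 : 1 ≤ (1 - z + z ^ 2 / 2) * (1 + z + z ^ 2 / 2) := by nlinarith [sq_nonneg (z ^ 2)]
  have h6 : Real.exp (-z) * Real.exp z ≤ (1 - z + z ^ 2 / 2) * Real.exp z := by
    rw [h2]; exact h5.trans (mul_le_mul_of_nonneg_left h1 h4)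
  exact le_of_mul_le_mul_right h6 (Real.exp_pos z)

lemma sum_Icc_half_pow_natAbs (n : ℕ) :
    ∑ m ∈ Finset.Icc (-(n : ℤ)) n, (1 / 2 : ℝ) ^ m.natAbs = 3 - 2 * (1 / 2) ^ n := by
  induction n with
  | zero => norm_num
  | succ n ih =>
    have h : Finset.Icc (-((n + 1 : ℕ) : ℤ)) ((n + 1 : ℕ) : ℤ) =
        insert ((n + 1 : ℕ) : ℤ) (insert (-((n + 1 : ℕ) : ℤ)) (Finset.Icc (-(n : ℤ)) n)) := by
      ext m
      simp only [Finset.mem_insert, Finset.mem_Icc]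
      omega
    rw [h, Finset.sum_insert, Finset.sum_insert, ih, Int.natAbs_neg, Int.natAbs_natCast]
    · ring
    · simp
    · simp only [Finset.mem_insert, Finset.mem_Icc]
      omega

/-- The integer points of a Euclidean ball are covered by a finite set of exponential size. -/
lemma exists_finset_int_points (d : ℕ) (R : ℝ) :
    ∃ T : Finset (Fin d → ℤ), (∀ m : Fin d → ℤ, ∑ k, (m k : ℝ) ^ 2 ≤ R → m ∈ T) ∧
      (T.card : ℝ) ≤ Real.exp R * 3 ^ d := by
  classical
  set n : ℕ := ⌈R⌉₊
  set B : Finset (Fin d → ℤ) := Fintype.piFinset fun _ => Finset.Icc (-(n : ℤ)) n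
  refine ⟨B.filter fun m => ∑ k, (m k : ℝ) ^ 2 ≤ R, ?_, ?_⟩
  · intro m hm
    rw [Finset.mem_filter]
    refine ⟨?_, hm⟩
    rw [Fintype.mem_piFinset]
    intro k
    have h1 : (m k : ℝ) ^ 2 ≤ R :=
      (Finset.single_le_sum (f := fun k => (m k : ℝ) ^ 2) (fun i _ => sq_nonneg _)
        (Finset.mem_univ k)).trans hm
    have h2 : ((m k ^ 2 : ℤ) : ℝ) ≤ ((n : ℤ) : ℝ) := by
      push_cast
      exact h1.trans (Nat.le_ceil R)
    have h3 : m k ^ 2 ≤ (n : ℤ) := by exact_mod_cast h2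
    rw [Finset.mem_Icc]
    constructor
    · nlinarith [sq_nonneg (m k + 1), sq_nonneg (m k)]
    · nlinarith [Int.le_self_sq (m k)]
  · have key : ∀ j : ℤ, Real.exp (-(j : ℝ) ^ 2) ≤ (1 / 2 : ℝ) ^ j.natAbs := by
      intro j
      have h1 : Real.exp (-1) ≤ 1 / 2 := by
        have := exp_neg_le_quadratic (z := 1) (by norm_num)
        norm_num at this ⊢
        exact this
      have h2 : ((j.natAbs : ℕ) : ℝ) ≤ (j : ℝ) ^ 2 := by
        have h3 : j.natAbs ≤ j.natAbs ^ 2 := Nat.le_self_pow two_ne_zero _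
        have h4 : ((j.natAbs : ℕ) : ℝ) ^ 2 = (j : ℝ) ^ 2 := by
          rw [Nat.cast_natAbs, Int.cast_abs, sq_abs]
        rw [← h4]
        exact_mod_cast h3
      calc Real.exp (-(j : ℝ) ^ 2) ≤ Real.exp (j.natAbs * (-1)) := by
            apply Real.exp_le_exp.2; linarith
        _ = Real.exp (-1) ^ j.natAbs := by rw [Real.exp_nat_mul]
        _ ≤ _ := pow_le_pow_left₀ (Real.exp_pos _).le h1 _
    -- Exponential weights: `1 ≤ exp (R - |m|²)` on the ball, and the sum of the weights over the
    -- box factors over coordinates, each factor being below `3`.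
    calc ((B.filter fun m => ∑ k, (m k : ℝ) ^ 2 ≤ R).card : ℝ)
        = ∑ m ∈ B.filter (fun m => ∑ k, (m k : ℝ) ^ 2 ≤ R), (1 : ℝ) := by simp
      _ ≤ ∑ m ∈ B.filter (fun m => ∑ k, (m k : ℝ) ^ 2 ≤ R),
            Real.exp R * ∏ k, (1 / 2 : ℝ) ^ (m k).natAbs := by
          refine Finset.sum_le_sum fun m hm => ?_
          have hm2 := (Finset.mem_filter.1 hm).2
          calc (1 : ℝ) ≤ Real.exp (R + ∑ k, -(m k : ℝ) ^ 2) := by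
                apply Real.one_le_exp
                rw [Finset.sum_neg_distrib]; linarith
            _ = Real.exp R * ∏ k, Real.exp (-(m k : ℝ) ^ 2) := by
                rw [Real.exp_add, Real.exp_sum]
            _ ≤ _ := by
                refine mul_le_mul_of_nonneg_left ?_ (Real.exp_pos R).le
                exact Finset.prod_le_prod (fun _ _ => (Real.exp_pos _).le) fun k _ => key _
      _ ≤ ∑ m ∈ B, Real.exp R * ∏ k, (1 / 2 : ℝ) ^ (m k).natAbs := by
          refine Finset.sum_le_sum_of_subset_of_nonneg (Finset.filter_subset _ _) ?_
          intros; positivity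
      _ = Real.exp R * ∏ _k : Fin d, ∑ j ∈ Finset.Icc (-(n : ℤ)) n, (1 / 2 : ℝ) ^ j.natAbs := by
          rw [← Finset.mul_sum, Finset.prod_univ_sum]
      _ ≤ Real.exp R * 3 ^ d := by
          refine mul_le_mul_of_nonneg_left ?_ (Real.exp_pos R).le
          rw [Finset.prod_const, Finset.card_univ, Fintype.card_fin, sum_Icc_half_pow_natAbs]
          have h1 : (0 : ℝ) < (1 / 2) ^ n := by positivity
          have h2 : ((1 : ℝ) / 2) ^ n ≤ 1 := pow_le_one₀ (by norm_num) (by norm_num)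
          exact pow_le_pow_left₀ (by linarith) (by linarith) _

/-- One of the two roundings of a coordinate to a lattice of mesh `h` increases a quadratic
function of that coordinate by at most `h² / 4` times its leading coefficient. -/
lemma exists_round_le {h : ℝ} (hh : 0 < h) (a b Q y : ℝ) (ha : 0 ≤ a) (hQ : 0 ≤ Q) :
    ∃ s : ℝ, (∃ m : ℤ, y + s = h * m) ∧ |s| ≤ h ∧ s * b + s ^ 2 * (Q - a) ≤ h ^ 2 / 4 * Q := by
  set p := Int.fract (y / h)
  have hp0 : 0 ≤ p := Int.fract_nonneg _
  have hp1 : p < 1 := Int.fract_lt_one _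
  have hy : y = h * (⌊y / h⌋ + p) := by
    rw [Int.floor_add_fract]; field_simp
  have hpp : p * (1 - p) ≤ 1 / 4 := by nlinarith [sq_nonneg (p - 1 / 2)]
  have hpp0 : 0 ≤ p * (1 - p) := mul_nonneg hp0 (by linarith)
  -- Round down with weight `1 - p` and up with weight `p`: the mean of `s` is `0` and that of `s²`
  -- is `h² p (1 - p) ≤ h² / 4`. If both roundings broke the bound, so would their average.
  by_contra! H
  have h1 := H (-(h * p)) ⟨⌊y / h⌋, by nth_rw 1 [hy]; ring⟩
    (by rw [abs_neg, abs_of_nonneg (by positivity)]; nlinarith)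
  have h2 := H (h * (1 - p)) ⟨⌊y / h⌋ + 1, by nth_rw 1 [hy]; push_cast; ring⟩
    (by rw [abs_of_nonneg (mul_nonneg hh.le (by linarith))]; nlinarith)
  have h3 : h ^ 2 / 4 * Q < (1 - p) * (-(h * p) * b + (-(h * p)) ^ 2 * (Q - a))
      + p * (h * (1 - p) * b + (h * (1 - p)) ^ 2 * (Q - a)) := by
    nlinarith [mul_lt_mul_of_pos_left h1 (sub_pos.2 hp1), mul_le_mul_of_nonneg_left h2.le hp0]
  have h4 : (1 - p) * (-(h * p) * b + (-(h * p)) ^ 2 * (Q - a))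
      + p * (h * (1 - p) * b + (h * (1 - p)) ^ 2 * (Q - a)) = h ^ 2 * (p * (1 - p)) * (Q - a) := by
    ring
  have h5 : h ^ 2 * (p * (1 - p)) * (Q - a) ≤ h ^ 2 * (p * (1 - p)) * Q :=
    mul_le_mul_of_nonneg_left (by linarith) (by positivity)
  have h6 : h ^ 2 * (p * (1 - p)) * Q ≤ h ^ 2 * (1 / 4) * Q := by gcongr
  linarith

/-- Rounding a vector to a lattice of mesh `h` coordinate by coordinate. -/
lemma exists_lattice_point_le {d N : ℕ} (x : Fin N → Fin d → ℝ) {h a : ℝ} (hh : 0 < h)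
    (ha : 0 ≤ a) (v : Fin d → ℝ) (T : Finset (Fin d)) :
    ∃ u : Fin d → ℝ, (∀ k ∈ T, (∃ m : ℤ, u k = h * m) ∧ |u k - v k| ≤ h) ∧
      (∀ k ∉ T, u k = v k) ∧
      ∑ i, (u ⬝ᵥ x i) ^ 2 - a * (u ⬝ᵥ u) ≤
        ∑ i, (v ⬝ᵥ x i) ^ 2 - a * (v ⬝ᵥ v) + h ^ 2 / 4 * ∑ k ∈ T, ∑ i, x i k ^ 2 := by
  classical
  induction T using Finset.induction_on with
  | empty => exact ⟨v, by simp, by simp, by simp⟩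
  | insert k T hk ih =>
    obtain ⟨u, hu1, hu2, hu3⟩ := ih
    -- Moving coordinate `k` by `s` changes the objective by `s * b + s ^ 2 * (Q - a)` for these `b`
    -- and `Q`.
    obtain ⟨s, hs1, hs2, hs3⟩ := exists_round_le hh a
      (2 * ∑ i, (u ⬝ᵥ x i) * x i k - 2 * a * u k) (∑ i, x i k ^ 2) (u k) ha
      (Finset.sum_nonneg fun i _ => sq_nonneg _)
    refine ⟨u + Pi.single k s, ?_, ?_, ?_⟩
    · intro l hl
      by_cases hlk : l = k
      · subst hlk
        simpa [hu2 l hk] using And.intro hs1 hs2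
      · have := hu1 l (Finset.mem_of_mem_insert_of_ne hl hlk)
        simpa [hlk] using this
    · intro l hl
      rw [Finset.mem_insert, not_or] at hl
      simpa [hl.1] using hu2 l hl.2
    · have e1 : ∑ i, ((u + Pi.single k s) ⬝ᵥ x i) ^ 2 = ∑ i, (u ⬝ᵥ x i) ^ 2
          + 2 * s * ∑ i, (u ⬝ᵥ x i) * x i k + s ^ 2 * ∑ i, x i k ^ 2 := by
        rw [Finset.mul_sum, Finset.mul_sum, ← Finset.sum_add_distrib, ← Finset.sum_add_distrib]
        refine Finset.sum_congr rfl fun i _ => ?_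
        rw [add_dotProduct, single_dotProduct]
        ring
      have e2 : (u + Pi.single k s) ⬝ᵥ (u + Pi.single k s) = u ⬝ᵥ u + 2 * s * u k + s ^ 2 := by
        simp only [add_dotProduct, dotProduct_add, single_dotProduct, dotProduct_single,
          Pi.add_apply, Pi.single_eq_same]
        ring
      rw [e1, e2, Finset.sum_insert hk]
      nlinarith

/-! ### Truncation of the sample vectors. -/

/-- The vector `x`, replaced by `0` when its squared norm exceeds `K`. -/
noncomputable def truncate {d : ℕ} (K : ℝ) (x : Fin d → ℝ) : Fin d → ℝ :=
  open Classical in if x ⬝ᵥ x ≤ K then x else 0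

lemma truncate_dotProduct_self_le {d : ℕ} {K : ℝ} (hK : 0 ≤ K) (x : Fin d → ℝ) :
    truncate K x ⬝ᵥ truncate K x ≤ K := by
  unfold truncate
  split_ifs with h
  · exact h
  · simpa using hK

lemma dotProduct_truncate_sq_le {d : ℕ} (K : ℝ) (u x : Fin d → ℝ) :
    (u ⬝ᵥ truncate K x) ^ 2 ≤ (u ⬝ᵥ x) ^ 2 := by
  unfold truncate
  split_ifs with h
  · exact le_rfl
  · simpa using sq_nonneg _

lemma measurable_dotProduct_left {d : ℕ} (u : Fin d → ℝ) :
    Measurable fun x : Fin d → ℝ => u ⬝ᵥ x := by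
  unfold dotProduct
  fun_prop

lemma measurable_truncate {d : ℕ} (K : ℝ) :
    Measurable (truncate K : (Fin d → ℝ) → Fin d → ℝ) := by
  unfold truncate
  refine Measurable.ite ?_ measurable_id measurable_const
  refine measurableSet_le ?_ measurable_const
  unfold dotProduct
  fun_prop

/-- If `x` is cut off, then `x ⬝ᵥ x > 4θ⁴d`, so the last subtracted term exceeds `θ⁴ (u ⬝ᵥ u)`, and
AM–GM makes the two subtracted terms dominate `(u ⬝ᵥ x) ^ 2`. For isotropic `x` with the
fourth-moment bound, each has mean at most `(u ⬝ᵥ u) / 4`, so truncation loses at most half of the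
second moment. -/
lemma le_dotProduct_truncate_sq {d : ℕ} (hd : 0 < d) {θ : ℝ} (hθ : 0 < θ) (u x : Fin d → ℝ)
    (hu : 0 < u ⬝ᵥ u) :
    (u ⬝ᵥ x) ^ 2 - (u ⬝ᵥ x) ^ 4 / (4 * θ ^ 4 * (u ⬝ᵥ u)) - (u ⬝ᵥ u) * (x ⬝ᵥ x) / (4 * d) ≤
      (u ⬝ᵥ truncate (4 * θ ^ 4 * d) x) ^ 2 := by
  have hd' : (0 : ℝ) < d := by exact_mod_cast hd
  have hx : 0 ≤ x ⬝ᵥ x := Finset.sum_nonneg fun k _ => mul_self_nonneg _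
  have h1 : 0 ≤ (u ⬝ᵥ x) ^ 4 / (4 * θ ^ 4 * (u ⬝ᵥ u)) := by positivity
  have h2 : 0 ≤ (u ⬝ᵥ u) * (x ⬝ᵥ x) / (4 * d) := by positivity
  unfold truncate
  split_ifs with h
  · linarith
  · push Not at h
    have h3 : (u ⬝ᵥ u) * θ ^ 4 ≤ (u ⬝ᵥ u) * (x ⬝ᵥ x) / (4 * d) := by
      rw [le_div_iff₀ (by positivity)]
      nlinarith
    have h4 : (u ⬝ᵥ x) ^ 2 ≤ (u ⬝ᵥ x) ^ 4 / (4 * θ ^ 4 * (u ⬝ᵥ u)) + (u ⬝ᵥ u) * θ ^ 4 := by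
      have : (u ⬝ᵥ x) ^ 4 / (4 * θ ^ 4 * (u ⬝ᵥ u)) + (u ⬝ᵥ u) * θ ^ 4 - (u ⬝ᵥ x) ^ 2 =
        ((u ⬝ᵥ x) ^ 2 - 2 * (u ⬝ᵥ u) * θ ^ 4) ^ 2 / (4 * θ ^ 4 * (u ⬝ᵥ u)) := by
        field_simp
        ring
      have h5 : 0 ≤ ((u ⬝ᵥ x) ^ 2 - 2 * (u ⬝ᵥ u) * θ ^ 4) ^ 2 / (4 * θ ^ 4 * (u ⬝ᵥ u)) := by
        positivity
      linarith
    rw [dotProduct_zero]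
    linarith

lemma integrable_pow_four {Ω : Type*} [MeasurableSpace Ω] {P : Measure Ω} [IsFiniteMeasure P]
    {f : Ω → ℝ} (hf : MemLp f 4 P) : Integrable (fun ω => f ω ^ 4) P := by
  have h := MemLp.integrable_norm_pow' (p := 4) (by exact_mod_cast hf)
  refine h.congr (Filter.Eventually.of_forall fun ω => ?_)
  simp only [Real.norm_eq_abs]
  exact Even.pow_abs (by decide) _

lemma integrable_sq_of_memLp_four {Ω : Type*} [MeasurableSpace Ω] {P : Measure Ω}
    [IsFiniteMeasure P] {f : Ω → ℝ} (hf : MemLp f 4 P) : Integrable (fun ω => f ω ^ 2) P :=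
  (hf.mono_exponent (p := 2) (by norm_num)).integrable_sq

/-! ### Lower tail of the empirical quadratic form. -/

section LowerBound

variable {Ω : Type*} [MeasurableSpace Ω] {P : Measure Ω} [IsProbabilityMeasure P] {d : ℕ}

lemma half_le_integral_truncate_sq (hd : 0 < d) {θ : ℝ} (hθ : 0 < θ) {x : Ω → Fin d → ℝ}
    (hx : AEMeasurable x P) (hL : ∀ u : Fin d → ℝ, MemLp (fun ω => u ⬝ᵥ x ω) 4 P)
    (h2 : ∀ u : Fin d → ℝ, ∫ ω, (u ⬝ᵥ x ω) ^ 2 ∂P = u ⬝ᵥ u)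
    (h4 : ∀ u : Fin d → ℝ, ∫ ω, (u ⬝ᵥ x ω) ^ 4 ∂P ≤ θ ^ 4 * (u ⬝ᵥ u) ^ 2)
    (u : Fin d → ℝ) (hu : 0 < u ⬝ᵥ u) :
    (u ⬝ᵥ u) / 2 ≤ ∫ ω, (u ⬝ᵥ truncate (4 * θ ^ 4 * d) (x ω)) ^ 2 ∂P := by
  have hd' : (0 : ℝ) < d := by exact_mod_cast hd
  have hsq : ∀ k, Integrable (fun ω => x ω k * x ω k) P := by
    intro k
    have := integrable_sq_of_memLp_four (hL (Pi.single k 1))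
    simpa [single_dotProduct, sq] using this
  have hxx : ∫ ω, x ω ⬝ᵥ x ω ∂P = d := by
    unfold dotProduct
    rw [integral_finsetSum _ fun k _ => hsq k]
    have : ∀ k, ∫ ω, x ω k * x ω k ∂P = 1 := by
      intro k
      have := h2 (Pi.single k 1)
      simpa [single_dotProduct, sq] using this
    simp [this]
  have hxxi : Integrable (fun ω => x ω ⬝ᵥ x ω) P := by
    unfold dotProduct
    exact integrable_finsetSum _ fun k _ => hsq k
  have i2 := integrable_sq_of_memLp_four (hL u)
  have i4 := integrable_pow_four (hL u)
  have hy : Integrable (fun ω => (u ⬝ᵥ truncate (4 * θ ^ 4 * d) (x ω)) ^ 2) P := by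
    refine i2.mono' ?_ (Filter.Eventually.of_forall fun ω => ?_)
    · exact ((((measurable_dotProduct_left u).comp (measurable_truncate _)).pow_const
        2).comp_aemeasurable hx).aestronglyMeasurable
    · rw [Real.norm_of_nonneg (sq_nonneg _)]
      exact dotProduct_truncate_sq_le _ _ _
  have hle := integral_mono ((i2.sub (i4.div_const (4 * θ ^ 4 * (u ⬝ᵥ u)))).sub
    ((hxxi.const_mul (u ⬝ᵥ u)).div_const (4 * d))) hy
    fun ω => le_dotProduct_truncate_sq hd hθ u (x ω) hu
  refine le_trans ?_ hle
  simp only [Pi.sub_apply]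
  rw [integral_sub, integral_sub, integral_div, integral_div, integral_const_mul, hxx, h2]
  · have h5 : (∫ ω, (u ⬝ᵥ x ω) ^ 4 ∂P) / (4 * θ ^ 4 * (u ⬝ᵥ u)) ≤ (u ⬝ᵥ u) / 4 := by
      rw [div_le_iff₀ (by positivity)]
      refine (h4 u).trans (le_of_eq ?_)
      ring
    have h6 : (u ⬝ᵥ u) * d / (4 * d) = (u ⬝ᵥ u) / 4 := by field_simp
    linarith
  · exact i2
  · exact i4.div_const _
  · exact i2.sub (i4.div_const _)
  · exact (hxxi.const_mul _).div_const _

lemma mgf_truncate_sq_le (hd : 0 < d) {θ : ℝ} (hθ : 0 < θ) {x : Ω → Fin d → ℝ}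
    (hx : AEMeasurable x P) (hL : ∀ u : Fin d → ℝ, MemLp (fun ω => u ⬝ᵥ x ω) 4 P)
    (h2 : ∀ u : Fin d → ℝ, ∫ ω, (u ⬝ᵥ x ω) ^ 2 ∂P = u ⬝ᵥ u)
    (h4 : ∀ u : Fin d → ℝ, ∫ ω, (u ⬝ᵥ x ω) ^ 4 ∂P ≤ θ ^ 4 * (u ⬝ᵥ u) ^ 2)
    (u : Fin d → ℝ) (hu : 0 < u ⬝ᵥ u) :
    mgf (fun ω => (u ⬝ᵥ truncate (4 * θ ^ 4 * d) (x ω)) ^ 2) P (-(1 / (4 * θ ^ 4 * (u ⬝ᵥ u)))) ≤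
      Real.exp (-(3 / (32 * θ ^ 4))) := by
  -- This `c` maximises `c|u|²/4 - c²θ⁴|u|⁴/2`, the exponent per observation for the threshold `N/4
  -- |u|²`; the maximum is `1/(32θ⁴)`.
  set c : ℝ := 1 / (4 * θ ^ 4 * (u ⬝ᵥ u)) with hc
  have hc0 : 0 < c := by positivity
  set y : Ω → ℝ := fun ω => (u ⬝ᵥ truncate (4 * θ ^ 4 * d) (x ω)) ^ 2 with hy
  have hy0 : ∀ ω, 0 ≤ y ω := fun ω => sq_nonneg _
  have hyle : ∀ ω, y ω ≤ (u ⬝ᵥ x ω) ^ 2 := fun ω => dotProduct_truncate_sq_le _ _ _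
  have i2 := integrable_sq_of_memLp_four (hL u)
  have i4 := integrable_pow_four (hL u)
  have hym : AEMeasurable y P := (((measurable_dotProduct_left u).comp
    (measurable_truncate _)).pow_const 2).comp_aemeasurable hx
  have hy2le : ∀ ω, y ω ^ 2 ≤ (u ⬝ᵥ x ω) ^ 4 := by
    intro ω
    calc y ω ^ 2 ≤ ((u ⬝ᵥ x ω) ^ 2) ^ 2 := pow_le_pow_left₀ (hy0 ω) (hyle ω) 2
      _ = _ := by ring
  have hyi : Integrable y P := i2.mono' hym.aestronglyMeasurable
    (Filter.Eventually.of_forall fun ω => by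
      rw [Real.norm_of_nonneg (hy0 ω)]; exact hyle ω)
  have hy2i : Integrable (fun ω => y ω ^ 2) P := i4.mono' (hym.pow_const 2).aestronglyMeasurable
    (Filter.Eventually.of_forall fun ω => by
      rw [Real.norm_of_nonneg (sq_nonneg _)]; exact hy2le ω)
  have hE : (u ⬝ᵥ u) / 2 ≤ ∫ ω, y ω ∂P := half_le_integral_truncate_sq hd hθ hx hL h2 h4 u hu
  have hE2 : ∫ ω, y ω ^ 2 ∂P ≤ θ ^ 4 * (u ⬝ᵥ u) ^ 2 :=
    (integral_mono hy2i i4 hy2le).trans (h4 u)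
  have hbound : mgf y P (-c) ≤ ∫ ω, (1 - c * y ω + c ^ 2 / 2 * y ω ^ 2) ∂P := by
    refine integral_mono ?_ (((integrable_const 1).sub (hyi.const_mul c)).add
      (hy2i.const_mul (c ^ 2 / 2))) fun ω => ?_
    · refine (integrable_const (1 : ℝ)).mono' ?_ (Filter.Eventually.of_forall fun ω => ?_)
      · exact (Real.measurable_exp.comp_aemeasurable (hym.const_mul _)).aestronglyMeasurable
      · rw [Real.norm_of_nonneg (Real.exp_pos _).le, Real.exp_le_one_iff]
        nlinarith [mul_nonneg hc0.le (hy0 ω)]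
    · have := exp_neg_le_quadratic (mul_nonneg hc0.le (hy0 ω))
      simp only [neg_mul]
      refine this.trans (le_of_eq ?_)
      ring
  have hval : ∫ ω, (1 - c * y ω + c ^ 2 / 2 * y ω ^ 2) ∂P =
      1 - c * ∫ ω, y ω ∂P + c ^ 2 / 2 * ∫ ω, y ω ^ 2 ∂P := by
    have i1 : Integrable (fun ω => 1 - c * y ω) P := (integrable_const 1).sub (hyi.const_mul c)
    rw [integral_add i1 (hy2i.const_mul (c ^ 2 / 2)),
      integral_sub (integrable_const 1) (hyi.const_mul c), integral_const_mul, integral_const_mul]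
    simp
  rw [hval] at hbound
  have h5 : c * ((u ⬝ᵥ u) / 2) ≤ c * ∫ ω, y ω ∂P := mul_le_mul_of_nonneg_left hE hc0.le
  have h6 : c ^ 2 / 2 * ∫ ω, y ω ^ 2 ∂P ≤ c ^ 2 / 2 * (θ ^ 4 * (u ⬝ᵥ u) ^ 2) :=
    mul_le_mul_of_nonneg_left hE2 (by positivity)
  have h7 : c * ((u ⬝ᵥ u) / 2) - c ^ 2 / 2 * (θ ^ 4 * (u ⬝ᵥ u) ^ 2) = 3 / (32 * θ ^ 4) := by
    rw [hc]
    field_simp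
    norm_num
  have h8 := Real.add_one_le_exp (-(3 / (32 * θ ^ 4)))
  linarith

/-- The lower tail of the truncated empirical quadratic form at a fixed vector. -/
lemma measure_sum_truncate_sq_lt_le {N : ℕ} (hd : 0 < d) {θ : ℝ} (hθ : 0 < θ)
    {x : Fin N → Ω → Fin d → ℝ} (hind : iIndepFun x P)
    (hx : ∀ i, AEMeasurable (x i) P)
    (hL : ∀ i, ∀ u : Fin d → ℝ, MemLp (fun ω => u ⬝ᵥ x i ω) 4 P)
    (h2 : ∀ i, ∀ u : Fin d → ℝ, ∫ ω, (u ⬝ᵥ x i ω) ^ 2 ∂P = u ⬝ᵥ u)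
    (h4 : ∀ i, ∀ u : Fin d → ℝ, ∫ ω, (u ⬝ᵥ x i ω) ^ 4 ∂P ≤ θ ^ 4 * (u ⬝ᵥ u) ^ 2)
    (u : Fin d → ℝ) :
    P.real {ω | ∑ i, (u ⬝ᵥ truncate (4 * θ ^ 4 * d) (x i ω)) ^ 2 < N / 4 * (u ⬝ᵥ u)} ≤
      Real.exp (-(N / (32 * θ ^ 4))) := by
  have hu0 : 0 ≤ u ⬝ᵥ u := Finset.sum_nonneg fun k _ => mul_self_nonneg _
  rcases hu0.eq_or_lt with hu | hu
  · have : {ω | ∑ i, (u ⬝ᵥ truncate (4 * θ ^ 4 * d) (x i ω)) ^ 2 < N / 4 * (u ⬝ᵥ u)} = ∅ := by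
      ext ω
      simp only [Set.mem_ofPred_eq, Set.mem_empty_iff_false, iff_false, not_lt, ← hu, mul_zero]
      exact Finset.sum_nonneg fun i _ => sq_nonneg _
    rw [this]
    simpa using (Real.exp_pos _).le
  set c : ℝ := 1 / (4 * θ ^ 4 * (u ⬝ᵥ u)) with hc
  have hc0 : 0 < c := by positivity
  set φ : (Fin d → ℝ) → ℝ := fun z => (u ⬝ᵥ truncate (4 * θ ^ 4 * d) z) ^ 2 with hφ
  have hφm : Measurable φ :=
    ((measurable_dotProduct_left u).comp (measurable_truncate _)).pow_const 2
  have hYm : ∀ i, AEMeasurable (fun ω => φ (x i ω)) P := fun i => hφm.comp_aemeasurable (hx i)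
  have hYind : iIndepFun (fun i ω => φ (x i ω)) P := hind.comp (fun _ => φ) fun _ => hφm
  have hmgf : mgf (∑ i, fun ω => φ (x i ω)) P (-c) ≤ Real.exp (-(3 / (32 * θ ^ 4))) ^ N := by
    rw [hYind.mgf_sum₀ hYm]
    calc ∏ i, mgf (fun ω => φ (x i ω)) P (-c)
        ≤ ∏ _i : Fin N, Real.exp (-(3 / (32 * θ ^ 4))) :=
          Finset.prod_le_prod (fun _ _ => mgf_nonneg) fun i _ =>
            mgf_truncate_sq_le hd hθ (hx i) (hL i) (h2 i) (h4 i) u hu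
      _ = _ := by simp
  have hint : Integrable (fun ω => Real.exp (-c * (∑ i, fun ω => φ (x i ω)) ω)) P := by
    refine (integrable_const (1 : ℝ)).mono' ?_ (Filter.Eventually.of_forall fun ω => ?_)
    · refine (Real.measurable_exp.comp_aemeasurable
        (AEMeasurable.const_mul ?_ _)).aestronglyMeasurable
      exact Finset.aemeasurable_sum _ fun i _ => hYm i
    · rw [Real.norm_of_nonneg (Real.exp_pos _).le, Real.exp_le_one_iff, Finset.sum_apply]
      have : 0 ≤ ∑ i, φ (x i ω) := Finset.sum_nonneg fun i _ => sq_nonneg _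
      nlinarith [mul_nonneg hc0.le this]
  have hch := measure_le_le_exp_mul_mgf (μ := P) (X := ∑ i, fun ω => φ (x i ω)) (t := -c)
    (N / 4 * (u ⬝ᵥ u)) (by linarith) hint
  refine (measureReal_mono ?_).trans (hch.trans ?_)
  · intro ω hω
    simp only [Set.mem_ofPred_eq, Finset.sum_apply] at hω ⊢
    exact hω.le
  · calc _ ≤ Real.exp (-(-c) * (N / 4 * (u ⬝ᵥ u))) * Real.exp (-(3 / (32 * θ ^ 4))) ^ N :=
          mul_le_mul_of_nonneg_left hmgf (Real.exp_pos _).le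
      _ = Real.exp (-(N / (32 * θ ^ 4))) := by
          rw [← Real.exp_nat_mul, ← Real.exp_add]
          congr 1
          rw [hc]
          field_simp
          ring

/-- Deterministic passage from lattice points to all vectors. -/
lemma quadratic_lower_of_lattice {N : ℕ} (hd : 0 < d) {θ : ℝ} (hθ : 1 ≤ θ)
    (x : Fin N → Fin d → ℝ) {h : ℝ} (hh : 0 < h) (hh2 : h ^ 2 * (8 * θ ^ 4 * d) = 1)
    (hlat : ∀ m : Fin d → ℤ, ∑ k, (m k : ℝ) ^ 2 ≤ 32 * θ ^ 4 * d →
      N / 4 * ((fun k => h * (m k : ℝ)) ⬝ᵥ (fun k => h * (m k : ℝ))) ≤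
        ∑ i, ((fun k => h * (m k : ℝ)) ⬝ᵥ truncate (4 * θ ^ 4 * d) (x i)) ^ 2)
    (t : Fin d → ℝ) : N / 8 * (t ⬝ᵥ t) ≤ ∑ i, (t ⬝ᵥ x i) ^ 2 := by
  have hθ4 : 1 ≤ θ ^ 4 := one_le_pow₀ hθ
  have hd' : (1 : ℝ) ≤ d := by exact_mod_cast hd
  have ht0 : 0 ≤ t ⬝ᵥ t := Finset.sum_nonneg fun k _ => mul_self_nonneg _
  rcases ht0.eq_or_lt with ht | ht
  · rw [← ht, mul_zero]
    exact Finset.sum_nonneg fun i _ => sq_nonneg _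
  set r := Real.sqrt (t ⬝ᵥ t) with hr
  have hr0 : 0 < r := Real.sqrt_pos.2 ht
  have hr2 : r ^ 2 = t ⬝ᵥ t := Real.sq_sqrt ht0
  set v : Fin d → ℝ := r⁻¹ • t with hv
  have hvv : v ⬝ᵥ v = 1 := by
    rw [hv, smul_dotProduct, dotProduct_smul, ← hr2, smul_eq_mul, smul_eq_mul]
    field_simp
  set K : ℝ := 4 * θ ^ 4 * d with hK
  -- With `a = N/4` the objective is nonnegative at the lattice point `u`. Rounding raised it by at
  -- most `N/8`, so at the unit vector `v` the form is at least `N/4 - N/8`.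
  obtain ⟨u, hu1, -, hu3⟩ := exists_lattice_point_le (fun i => truncate K (x i)) hh
    (a := (N : ℝ) / 4) (by positivity) v Finset.univ
  choose m hm using fun k => (hu1 k (Finset.mem_univ k)).1
  have hum : u = fun k => h * (m k : ℝ) := funext hm
  -- The bound `4` fixes the radius of the integer ball: `∑ k, m k ^ 2 ≤ 4 / h ^ 2 = 32θ⁴d`.
  have huu : u ⬝ᵥ u ≤ 4 := by
    have h1 : u ⬝ᵥ u ≤ ∑ k, (2 * (v k * v k) + 2 * h ^ 2) := by
      refine Finset.sum_le_sum fun k _ => ?_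
      have h2 := sq_le_sq' (neg_le_of_abs_le (hu1 k (Finset.mem_univ k)).2)
        (le_of_abs_le (hu1 k (Finset.mem_univ k)).2)
      nlinarith [sq_nonneg (u k - 2 * v k)]
    rw [Finset.sum_add_distrib, ← Finset.mul_sum] at h1
    simp only [Finset.sum_const, Finset.card_univ, Fintype.card_fin, nsmul_eq_mul] at h1
    change _ ≤ 2 * (v ⬝ᵥ v) + _ at h1
    have h3 : h ^ 2 * d ≤ 1 := by
      rw [← hh2]
      refine mul_le_mul_of_nonneg_left ?_ (sq_nonneg h)
      nlinarith
    nlinarith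
  have hms : ∑ k, (m k : ℝ) ^ 2 ≤ 32 * θ ^ 4 * d := by
    have h1 : u ⬝ᵥ u = h ^ 2 * ∑ k, (m k : ℝ) ^ 2 := by
      rw [hum, Finset.mul_sum]
      exact Finset.sum_congr rfl fun k _ => by ring
    have h2 : h ^ 2 * ∑ k, (m k : ℝ) ^ 2 ≤ h ^ 2 * (32 * θ ^ 4 * d) := by
      rw [← h1]; linarith
    exact le_of_mul_le_mul_left h2 (by positivity)
  have hlow := hlat m hms
  rw [← hum] at hlow
  have htr : ∑ k, ∑ i, truncate K (x i) k ^ 2 ≤ N * K := by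
    rw [Finset.sum_comm]
    calc ∑ i, ∑ k, truncate K (x i) k ^ 2 ≤ ∑ _i : Fin N, K := by
          refine Finset.sum_le_sum fun i _ => ?_
          refine le_trans (le_of_eq ?_) (truncate_dotProduct_self_le (by positivity) (x i))
          exact Finset.sum_congr rfl fun k _ => by ring
      _ = N * K := by simp
  have h8 : h ^ 2 / 4 * ∑ k, ∑ i, truncate K (x i) k ^ 2 ≤ N / 8 := by
    calc _ ≤ h ^ 2 / 4 * (N * K) := mul_le_mul_of_nonneg_left htr (by positivity)
      _ = N / 8 * (h ^ 2 * (8 * θ ^ 4 * d)) := by rw [hK]; ring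
      _ = N / 8 := by rw [hh2, mul_one]
  have hv8 : (N : ℝ) / 8 ≤ ∑ i, (v ⬝ᵥ truncate K (x i)) ^ 2 := by
    rw [hvv] at hu3
    linarith
  have hv9 : (N : ℝ) / 8 ≤ ∑ i, (v ⬝ᵥ x i) ^ 2 :=
    hv8.trans (Finset.sum_le_sum fun i _ => dotProduct_truncate_sq_le _ _ _)
  have htv : t = r • v := by
    rw [hv, smul_smul, mul_inv_cancel₀ hr0.ne', one_smul]
  calc N / 8 * (t ⬝ᵥ t) = r ^ 2 * (N / 8) := by rw [hr2]; ring
    _ ≤ r ^ 2 * ∑ i, (v ⬝ᵥ x i) ^ 2 := mul_le_mul_of_nonneg_left hv9 (sq_nonneg r)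
    _ = ∑ i, (t ⬝ᵥ x i) ^ 2 := by
        rw [Finset.mul_sum]
        refine Finset.sum_congr rfl fun i _ => ?_
        rw [htv, smul_dotProduct r v, smul_eq_mul]
        ring

/-- Lower bound on the smallest eigenvalue of an empirical covariance matrix with isotropic rows
satisfying an `L₄`–`L₂` norm equivalence. -/
theorem measure_exists_quadratic_lt_le {N : ℕ} (hd : 0 < d) {θ : ℝ} (hθ : 1 ≤ θ)
    (hN : 10000 * θ ^ 8 * d ≤ N)
    {x : Fin N → Ω → Fin d → ℝ} (hind : iIndepFun x P)
    (hx : ∀ i, AEMeasurable (x i) P)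
    (hL : ∀ i, ∀ u : Fin d → ℝ, MemLp (fun ω => u ⬝ᵥ x i ω) 4 P)
    (h2 : ∀ i, ∀ u : Fin d → ℝ, ∫ ω, (u ⬝ᵥ x i ω) ^ 2 ∂P = u ⬝ᵥ u)
    (h4 : ∀ i, ∀ u : Fin d → ℝ, ∫ ω, (u ⬝ᵥ x i ω) ^ 4 ∂P ≤ θ ^ 4 * (u ⬝ᵥ u) ^ 2) :
    P.real {ω | ∃ t : Fin d → ℝ, ∑ i, (t ⬝ᵥ x i ω) ^ 2 < N / 8 * (t ⬝ᵥ t)} ≤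
      Real.exp (-(N / (64 * θ ^ 8))) := by
  have hθ0 : 0 < θ := by linarith
  have hθ4 : 1 ≤ θ ^ 4 := one_le_pow₀ hθ
  have hd' : (1 : ℝ) ≤ d := by exact_mod_cast hd
  -- The mesh makes the rounding cost `h²/4 · N · 4θ⁴d` equal to `N/8`.
  set h : ℝ := Real.sqrt (1 / (8 * θ ^ 4 * d)) with hhdef
  have hh : 0 < h := Real.sqrt_pos.2 (by positivity)
  have hh2 : h ^ 2 * (8 * θ ^ 4 * d) = 1 := by
    rw [hhdef, Real.sq_sqrt (by positivity)]
    field_simp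
  obtain ⟨T, hT, hTcard⟩ := exists_finset_int_points d (32 * θ ^ 4 * d)
  set bad : (Fin d → ℝ) → Set Ω := fun u =>
    {ω | ∑ i, (u ⬝ᵥ truncate (4 * θ ^ 4 * d) (x i ω)) ^ 2 < N / 4 * (u ⬝ᵥ u)}
  have hsub : {ω | ∃ t : Fin d → ℝ, ∑ i, (t ⬝ᵥ x i ω) ^ 2 < N / 8 * (t ⬝ᵥ t)} ⊆
      ⋃ m ∈ T, bad (fun k => h * (m k : ℝ)) := by
    rintro ω ⟨t, ht⟩
    by_contra hω
    simp only [Set.mem_iUnion, not_exists] at hω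
    refine ht.not_ge (quadratic_lower_of_lattice hd hθ (fun i => x i ω) hh hh2 ?_ t)
    intro m hm
    exact not_lt.1 (hω m (hT m hm))
  have h3 : (3 : ℝ) ^ d ≤ Real.exp (2 * d) := by
    have h31 : (3 : ℝ) ≤ Real.exp 2 := by
      have := Real.add_one_le_exp (2 : ℝ)
      linarith
    calc (3 : ℝ) ^ d ≤ Real.exp 2 ^ d := pow_le_pow_left₀ (by norm_num) h31 _
      _ = Real.exp (2 * d) := by rw [← Real.exp_nat_mul, mul_comm]
  calc _ ≤ P.real (⋃ m ∈ T, bad (fun k => h * (m k : ℝ))) :=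
        measureReal_mono hsub (measure_ne_top _ _)
    _ ≤ ∑ m ∈ T, P.real (bad (fun k => h * (m k : ℝ))) := measureReal_biUnion_finset_le _ _
    _ ≤ ∑ _m ∈ T, Real.exp (-(N / (32 * θ ^ 4))) := Finset.sum_le_sum fun m _ =>
        measure_sum_truncate_sq_lt_le hd hθ0 hind hx hL h2 h4 _
    _ = T.card * Real.exp (-(N / (32 * θ ^ 4))) := by rw [Finset.sum_const, nsmul_eq_mul]
    _ ≤ Real.exp (32 * θ ^ 4 * d) * Real.exp (2 * d) * Real.exp (-(N / (32 * θ ^ 4))) := by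
        gcongr
        exact hTcard.trans (mul_le_mul_of_nonneg_left h3 (Real.exp_pos _).le)
    _ ≤ Real.exp (-(N / (64 * θ ^ 8))) := by
        rw [← Real.exp_add, ← Real.exp_add]
        refine Real.exp_le_exp.2 ?_
        have e1 : (N : ℝ) / (64 * θ ^ 8) ≤ N / (64 * θ ^ 4) := by
          gcongr
          norm_num
        have e2 : (N : ℝ) / (32 * θ ^ 4) = N / (64 * θ ^ 4) + N / (64 * θ ^ 4) := by
          ring
        -- The union bound uses at most half of the exponent `N/(32θ⁴)`, as `34 · 64 ≤ 10000`.
        have e3 : 34 * θ ^ 4 * d ≤ N / (64 * θ ^ 4) := by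
          rw [le_div_iff₀ (by positivity)]
          refine le_trans ?_ hN
          have : 0 ≤ θ ^ 8 * d := by positivity
          nlinarith
        nlinarith
end LowerBound

/-! ### Second-moment control of the noise. -/

/-- The strict inequality keeps the bound true for `c = 0`, the noiseless case: then `S = 0` almost
everywhere. -/
lemma markov_strict {Ω : Type*} [MeasurableSpace Ω] {P : Measure Ω} [IsProbabilityMeasure P]
    {S : Ω → ℝ} (hS : Integrable S P) (hS0 : ∀ ω, 0 ≤ S ω) {c x : ℝ} (hc : ∫ ω, S ω ∂P ≤ c)
    (hx : 0 < x) : P.real {ω | c * x < S ω} ≤ 1 / x := by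
  have hI0 : 0 ≤ ∫ ω, S ω ∂P := integral_nonneg hS0
  rcases (hI0.trans hc).eq_or_lt with h | h
  · have h0 : S =ᵐ[P] 0 := (integral_eq_zero_iff_of_nonneg hS0 hS).1 (le_antisymm (h ▸ hc) hI0)
    have : P.real {ω | c * x < S ω} = 0 := by
      rw [measureReal_eq_zero_iff]
      refine measure_mono_null (fun ω hω => ?_) (ae_iff.1 h0)
      simp only [Set.mem_ofPred_eq, ← h, zero_mul] at hω ⊢
      exact hω.ne'
    rw [this]
    positivity
  · have h1 := mul_meas_ge_le_integral_of_nonneg (Filter.Eventually.of_forall hS0) hS (c * x)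
    have h2 : P.real {ω | c * x < S ω} ≤ P.real {ω | c * x ≤ S ω} :=
      measureReal_mono fun ω (hω : c * x < S ω) => hω.le
    rw [le_div_iff₀ hx]
    have h3 : (c * x) * P.real {ω | c * x ≤ S ω} ≤ c := h1.trans hc
    have h4 : x * P.real {ω | c * x ≤ S ω} ≤ 1 := by
      refine le_of_mul_le_mul_left ?_ h
      linarith
    nlinarith

/-- Chebyshev bound for the squared norm of a sum of independent centred random vectors. -/
lemma measure_sum_sq_gt_le {Ω : Type*} [MeasurableSpace Ω] {P : Measure Ω}
    [IsProbabilityMeasure P] {N d : ℕ} {W : Fin N → Ω → Fin d → ℝ} (hind : iIndepFun W P)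
    (hL : ∀ i k, MemLp (fun ω => W i ω k) 2 P) (h0 : ∀ i k, ∫ ω, W i ω k ∂P = 0)
    {s : ℝ} (hs : ∀ i k, ∫ ω, W i ω k ^ 2 ∂P ≤ s) {x : ℝ} (hx : 0 < x) :
    P.real {ω | (N * d * s) * x < ∑ k, (∑ i, W i ω k) ^ 2} ≤ 1 / x := by
  have hsum : ∀ k, MemLp (fun ω => ∑ i, W i ω k) 2 P := fun k =>
    memLp_finsetSum _ fun i _ => hL i k
  refine markov_strict (integrable_finsetSum _ fun k _ => (hsum k).integrable_sq)
    (fun ω => Finset.sum_nonneg fun k _ => sq_nonneg _) ?_ hx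
  rw [integral_finsetSum _ fun k _ => (hsum k).integrable_sq]
  have hk : ∀ k, ∫ ω, (∑ i, W i ω k) ^ 2 ∂P ≤ N * s := by
    intro k
    have hpair : Set.Pairwise (↑(Finset.univ : Finset (Fin N)))
        fun i j => IndepFun (fun ω => W i ω k) (fun ω => W j ω k) P := fun i _ j _ hij =>
      (hind.comp (fun _ w => w k) fun _ => measurable_pi_apply k).indepFun hij
    have hvar := IndepFun.variance_sum (s := Finset.univ) (fun i _ => hL i k) hpair
    have hfun : (∑ i, fun ω => W i ω k) = fun ω => ∑ i, W i ω k := by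
      ext ω; simp
    have hmean : ∫ ω, ∑ i, W i ω k ∂P = 0 := by
      rw [integral_finsetSum _ fun i _ => (hL i k).integrable (by norm_num)]
      simp [h0]
    rw [hfun, variance_of_integral_eq_zero (hsum k).aemeasurable hmean] at hvar
    rw [hvar]
    calc ∑ i, variance (fun ω => W i ω k) P ≤ ∑ _i : Fin N, s := by
          refine Finset.sum_le_sum fun i _ => ?_
          rw [variance_of_integral_eq_zero (hL i k).aemeasurable (h0 i k)]
          exact hs i k
      _ = N * s := by simp
  calc ∑ k, ∫ ω, (∑ i, W i ω k) ^ 2 ∂P ≤ ∑ _k : Fin d, N * s := Finset.sum_le_sum fun k _ => hk k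
    _ = N * d * s := by simp; ring

/-! ### Orthonormal coordinates on the span of the dictionary. -/

/-- An orthonormal system of measurable functions representing the span of a dictionary. -/
lemma exists_orthonormal_dictSpan {𝒳 : Type*} [MeasurableSpace 𝒳] (μ : Measure 𝒳) {M : ℕ}
    (F : Fin M → 𝒳 → ℝ) (hF : ∀ j, MemLp (F j) 2 μ) :
    ∃ d : ℕ, d ≤ M ∧ ∃ e : Fin d → 𝒳 → ℝ, (∀ k, Measurable (e k)) ∧ (∀ k, MemLp (e k) 2 μ) ∧
      (∀ k l, ∫ x, e k x * e l x ∂μ = if k = l then 1 else 0) ∧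
      (∀ j, ∃ a : Fin d → ℝ, F j =ᵐ[μ] fun x => a ⬝ᵥ fun k => e k x) ∧
      (∀ k, ∃ f ∈ dictSpan F, f =ᵐ[μ] e k) := by
  -- The dictionary may be dependent in `L₂`, so the basis is taken in the span of its classes; its
  -- vectors then agree with span elements only almost everywhere.
  set G : Fin M → Lp ℝ 2 μ := fun j => (hF j).toLp (F j)
  set V : Submodule ℝ (Lp ℝ 2 μ) := Submodule.span ℝ (Set.range G) with hV
  have : FiniteDimensional ℝ V := FiniteDimensional.span_of_finite ℝ (Set.finite_range G)
  set b := stdOrthonormalBasis ℝ V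
  refine ⟨Module.finrank ℝ V, ?_, fun k => ((b k : Lp ℝ 2 μ) : 𝒳 → ℝ), ?_, ?_, ?_, ?_, ?_⟩
  · exact (finrank_range_le_card (R := ℝ) G).trans_eq (Fintype.card_fin M)
  · exact fun k => (Lp.stronglyMeasurable _).measurable
  · exact fun k => Lp.memLp _
  · intro k l
    have h1 := orthonormal_iff_ite.1 b.orthonormal l k
    rw [Submodule.coe_inner, L2.inner_def] at h1
    simp only [eq_comm (a := l), RCLike.inner_apply, conj_trivial] at h1
    exact h1
  · intro j
    have hj : G j ∈ V := Submodule.subset_span ⟨j, rfl⟩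
    refine ⟨fun k => b.repr ⟨G j, hj⟩ k, ?_⟩
    have h1 : G j = ∑ k, b.repr ⟨G j, hj⟩ k • (b k : Lp ℝ 2 μ) := by
      have := congrArg (Subtype.val) (b.sum_repr ⟨G j, hj⟩)
      simpa using this.symm
    have h2 : (G j : 𝒳 → ℝ) =ᵐ[μ] F j := (hF j).coeFn_toLp
    refine h2.symm.trans ?_
    set a := fun k => b.repr ⟨G j, hj⟩ k
    have h3 : ((∑ k, a k • (b k : Lp ℝ 2 μ) : Lp ℝ 2 μ) : 𝒳 → ℝ) =ᵐ[μ]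
        fun x => a ⬝ᵥ fun k => ((b k : Lp ℝ 2 μ) : 𝒳 → ℝ) x := by
      refine (Lp.coeFn_finsetSum _ _).trans ?_
      have h4 : ∀ᵐ x ∂μ, ∀ k, ((a k • (b k : Lp ℝ 2 μ) : Lp ℝ 2 μ) : 𝒳 → ℝ) x =
          a k * ((b k : Lp ℝ 2 μ) : 𝒳 → ℝ) x :=
        ae_all_iff.2 fun k => Lp.coeFn_smul _ _
      filter_upwards [h4] with x hx
      simp only [Finset.sum_apply, hx, dotProduct]
    rw [h1]
    exact h3
  · intro k
    have key : ∀ g ∈ V, ∃ f ∈ dictSpan F, f =ᵐ[μ] (g : 𝒳 → ℝ) := by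
      intro g hg
      induction hg using Submodule.span_induction with
      | mem g hg =>
        obtain ⟨j, rfl⟩ := hg
        exact ⟨F j, Submodule.subset_span ⟨j, rfl⟩, (hF j).coeFn_toLp.symm⟩
      | zero => exact ⟨0, Submodule.zero_mem _, (Lp.coeFn_zero _ _ _).symm⟩
      | add g₁ g₂ _ _ h₁ h₂ =>
        obtain ⟨f₁, hf₁, e₁⟩ := h₁
        obtain ⟨f₂, hf₂, e₂⟩ := h₂
        exact ⟨f₁ + f₂, Submodule.add_mem _ hf₁ hf₂, (e₁.add e₂).trans (Lp.coeFn_add _ _).symm⟩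
      | smul c g _ h =>
        obtain ⟨f, hf, e⟩ := h
        exact ⟨c • f, Submodule.smul_mem _ c hf,
          (e.const_smul c).trans (Lp.coeFn_smul _ _).symm⟩
    exact key _ (b k).2

lemma toReal_eLpNorm_pow {α : Type*} [MeasurableSpace α] {μ : Measure α} {f : α → ℝ}
    (hf : AEStronglyMeasurable f μ) {n : ℕ} (hn : n ≠ 0) (hev : Even n) :
    (eLpNorm f n μ).toReal ^ n = ∫ x, f x ^ n ∂μ := by
  rw [toReal_eLpNorm hf, lpNorm_eq_integral_norm_rpow_toReal (by exact_mod_cast hn)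
    (ENNReal.natCast_ne_top n) hf]
  simp only [ENNReal.toReal_natCast, Real.rpow_natCast, Real.norm_eq_abs, hev.pow_abs]
  exact Real.rpow_inv_natCast_pow (integral_nonneg fun x => hev.pow_nonneg _) hn

lemma memLp_of_mem_dictSpan {𝒳 : Type*} [MeasurableSpace 𝒳] {μ : Measure 𝒳} {M : ℕ}
    {F : Fin M → 𝒳 → ℝ} (hF : ∀ j, MemLp (F j) 2 μ) {f : 𝒳 → ℝ} (hf : f ∈ dictSpan F) :
    MemLp f 2 μ := by
  unfold dictSpan at hf
  induction hf using Submodule.span_induction with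
  | mem g hg => obtain ⟨j, rfl⟩ := hg; exact hF j
  | zero => exact MemLp.zero
  | add g₁ g₂ _ _ h₁ h₂ => exact h₁.add h₂
  | smul c g _ h => exact h.const_smul c

/-- Pointwise transfer of a representation of the dictionary to its span. -/
lemma exists_coeff_of_mem_dictSpan {𝒳 : Type*} {M d : ℕ} {F : Fin M → 𝒳 → ℝ}
    {e : 𝒳 → Fin d → ℝ} (a : Fin M → Fin d → ℝ) {f : 𝒳 → ℝ} (hf : f ∈ dictSpan F) :
    ∃ t : Fin d → ℝ, ∀ x, (∀ j, F j x = a j ⬝ᵥ e x) → f x = t ⬝ᵥ e x := by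
  unfold dictSpan at hf
  induction hf using Submodule.span_induction with
  | mem g hg => obtain ⟨j, rfl⟩ := hg; exact ⟨a j, fun x hx => hx j⟩
  | zero => exact ⟨0, fun x _ => by simp⟩
  | add g₁ g₂ _ _ h₁ h₂ =>
    obtain ⟨t₁, ht₁⟩ := h₁
    obtain ⟨t₂, ht₂⟩ := h₂
    exact ⟨t₁ + t₂, fun x hx => by rw [Pi.add_apply, ht₁ x hx, ht₂ x hx, add_dotProduct]⟩
  | smul c g _ h =>
    obtain ⟨t, ht⟩ := h
    exact ⟨c • t, fun x hx => by rw [Pi.smul_apply, ht x hx, smul_dotProduct]⟩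

lemma exists_mem_dictSpan_ae_eq {𝒳 : Type*} [MeasurableSpace 𝒳] {μ : Measure 𝒳} {M d : ℕ}
    {F : Fin M → 𝒳 → ℝ} {e : Fin d → 𝒳 → ℝ} (he : ∀ k, ∃ f ∈ dictSpan F, f =ᵐ[μ] e k)
    (t : Fin d → ℝ) : ∃ f ∈ dictSpan F, f =ᵐ[μ] fun x => t ⬝ᵥ fun k => e k x := by
  choose f hf hfe using he
  refine ⟨∑ k, t k • f k, Submodule.sum_mem _ fun k _ => Submodule.smul_mem _ _ (hf k), ?_⟩
  filter_upwards [ae_all_iff.2 hfe] with x hx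
  simp [dotProduct, hx]

lemma integral_dotProduct_sq {𝒳 : Type*} [MeasurableSpace 𝒳] {μ : Measure 𝒳} {d : ℕ}
    {e : Fin d → 𝒳 → ℝ} (heL : ∀ k, MemLp (e k) 2 μ)
    (heo : ∀ k l, ∫ x, e k x * e l x ∂μ = if k = l then 1 else 0) (t : Fin d → ℝ) :
    ∫ x, (t ⬝ᵥ fun k => e k x) ^ 2 ∂μ = t ⬝ᵥ t := by
  have hi : ∀ k l, Integrable (fun x => t k * t l * (e k x * e l x)) μ := fun k l =>
    ((heL k).integrable_mul (heL l)).const_mul _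
  have h1 : ∀ x, (t ⬝ᵥ fun k => e k x) ^ 2 = ∑ k, ∑ l, t k * t l * (e k x * e l x) := by
    intro x
    unfold dotProduct
    rw [sq, Finset.sum_mul_sum]
    exact Finset.sum_congr rfl fun k _ => Finset.sum_congr rfl fun l _ => by ring
  simp only [h1]
  rw [integral_finsetSum _ fun k _ => integrable_finsetSum _ fun l _ => hi k l]
  refine Finset.sum_congr rfl fun k _ => ?_
  rw [integral_finsetSum _ fun l _ => hi k l]
  simp [integral_const_mul, heo]

/-- The `L₄`–`L₂` equivalence in coordinates. -/
lemma memLp_four_and_integral_le {𝒳 : Type*} [MeasurableSpace 𝒳] {μ : Measure 𝒳} {M d : ℕ}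
    {F : Fin M → 𝒳 → ℝ} {e : Fin d → 𝒳 → ℝ} (heL : ∀ k, MemLp (e k) 2 μ)
    (heo : ∀ k l, ∫ x, e k x * e l x ∂μ = if k = l then 1 else 0)
    (he : ∀ k, ∃ f ∈ dictSpan F, f =ᵐ[μ] e k) {θ : ℝ} (hθ : 0 < θ)
    (hnorm : ∀ f ∈ dictSpan F, eLpNorm f 4 μ ≤ ENNReal.ofReal θ * eLpNorm f 2 μ)
    (t : Fin d → ℝ) :
    MemLp (fun x => t ⬝ᵥ fun k => e k x) 4 μ ∧
      ∫ x, (t ⬝ᵥ fun k => e k x) ^ 4 ∂μ ≤ θ ^ 4 * (t ⬝ᵥ t) ^ 2 := by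
  obtain ⟨f, hf, hfe⟩ := exists_mem_dictSpan_ae_eq he t
  have h1 := hnorm f hf
  rw [eLpNorm_congr_ae hfe, eLpNorm_congr_ae hfe] at h1
  set g : 𝒳 → ℝ := fun x => t ⬝ᵥ fun k => e k x with hg
  have hg2 : MemLp g 2 μ := by
    have : g = fun x => ∑ k, t k * e k x := rfl
    rw [this]
    exact memLp_finsetSum _ fun k _ => (heL k).const_mul (t k)
  have hfin : ENNReal.ofReal θ * eLpNorm g 2 μ ≠ ⊤ :=
    ENNReal.mul_ne_top ENNReal.ofReal_ne_top hg2.eLpNorm_ne_top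
  refine ⟨⟨hg2.aestronglyMeasurable, h1.trans_lt hfin.lt_top⟩, ?_⟩
  have h2 := ENNReal.toReal_mono hfin h1
  rw [ENNReal.toReal_mul, ENNReal.toReal_ofReal hθ.le] at h2
  have e2 := toReal_eLpNorm_pow hg2.aestronglyMeasurable (n := 2) (by norm_num) (by decide)
  have e4 := toReal_eLpNorm_pow hg2.aestronglyMeasurable (n := 4) (by norm_num) (by decide)
  rw [integral_dotProduct_sq heL heo] at e2
  rw [← e4, ← e2]
  calc (eLpNorm g (4 : ℕ) μ).toReal ^ 4 ≤ (θ * (eLpNorm g 2 μ).toReal) ^ 4 :=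
        pow_le_pow_left₀ ENNReal.toReal_nonneg h2 4
    _ = _ := by push_cast; ring

lemma memLp_comp_of_hasLaw {Ω 𝒳 : Type*} [MeasurableSpace Ω] [MeasurableSpace 𝒳]
    {P : Measure Ω} {μ : Measure 𝒳} {X : Ω → 𝒳} (hX : HasLaw X μ P) {f : 𝒳 → ℝ} {p : ENNReal}
    (hf : MemLp f p μ) : MemLp (fun ω => f (X ω)) p P := by
  have h : MemLp f p (P.map X) := by rwa [hX.map_eq]
  exact (memLp_map_measure_iff h.aestronglyMeasurable hX.aemeasurable).1 h

/-! ### Excess risk and orthogonality of the oracle residual. -/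

section Risk

variable {𝒳 Ω₀ : Type*} [MeasurableSpace 𝒳] {μ : Measure 𝒳} [MeasurableSpace Ω₀]
  {P₀ : Measure Ω₀} {X : Ω₀ → 𝒳} {Y : Ω₀ → ℝ} {M : ℕ} {F : Fin M → 𝒳 → ℝ} {fstar : 𝒳 → ℝ}

lemma risk_add_smul (hX : HasLaw X μ P₀) (hF : ∀ j, MemLp (F j) 2 μ)
    (hζ : MemLp (fun ω => Y ω - fstar (X ω)) 2 P₀) {h : 𝒳 → ℝ} (hh : h ∈ dictSpan F) (s : ℝ) :
    risk P₀ X Y (fstar + s • h) = risk P₀ X Y fstar -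
      2 * s * ∫ ω, (Y ω - fstar (X ω)) * h (X ω) ∂P₀ + s ^ 2 * ∫ ω, h (X ω) ^ 2 ∂P₀ := by
  have hL := memLp_comp_of_hasLaw hX (memLp_of_mem_dictSpan hF hh)
  have i1 := hζ.integrable_sq
  have i2 : Integrable (fun ω => 2 * s * ((Y ω - fstar (X ω)) * h (X ω))) P₀ :=
    (hζ.integrable_mul hL).const_mul _
  have i3 := hL.integrable_sq.const_mul (s ^ 2)
  have i12 : Integrable (fun ω => (Y ω - fstar (X ω)) ^ 2 -
    2 * s * ((Y ω - fstar (X ω)) * h (X ω))) P₀ := i1.sub i2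
  unfold risk
  rw [← integral_const_mul, ← integral_const_mul, ← integral_sub i1 i2, ← integral_add i12 i3]
  refine integral_congr_ae (Filter.Eventually.of_forall fun ω => ?_)
  simp only [Pi.add_apply, Pi.smul_apply, smul_eq_mul]
  ring

/-- First-order condition: `s²J - 2sI ≥ 0` for all real `s` forces `I = 0`. -/
lemma integral_oracle_residual_mul (hX : HasLaw X μ P₀) (hF : ∀ j, MemLp (F j) 2 μ)
    (hζ : MemLp (fun ω => Y ω - fstar (X ω)) 2 P₀) (hstar : IsOracle P₀ X Y F fstar)
    {h : 𝒳 → ℝ} (hh : h ∈ dictSpan F) :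
    ∫ ω, (Y ω - fstar (X ω)) * h (X ω) ∂P₀ = 0 := by
  set I := ∫ ω, (Y ω - fstar (X ω)) * h (X ω) ∂P₀ with hI
  set J := ∫ ω, h (X ω) ^ 2 ∂P₀ with hJ
  have hJ0 : 0 ≤ J := integral_nonneg fun ω => sq_nonneg _
  have key : ∀ s : ℝ, 0 ≤ - 2 * s * I + s ^ 2 * J := by
    intro s
    have h1 := hstar.2 _ (Submodule.add_mem _ hstar.1 (Submodule.smul_mem _ s hh))
    rw [risk_add_smul hX hF hζ hh s] at h1
    linarith
  -- The `+ 1` avoids division by zero when `J = 0`.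
  have h2 := key (I / (J + 1))
  have h3 : -2 * (I / (J + 1)) * I + (I / (J + 1)) ^ 2 * J = -(I ^ 2 * (J + 2) / (J + 1) ^ 2) := by
    field_simp
    ring
  rw [h3] at h2
  have h4 : 0 ≤ I ^ 2 / (J + 1) ^ 2 := by positivity
  have h5 : I ^ 2 * (J + 2) / (J + 1) ^ 2 = I ^ 2 / (J + 1) ^ 2 * (J + 2) := by ring
  rw [h5] at h2
  have h6 : I ^ 2 / (J + 1) ^ 2 = 0 := by nlinarith
  rcases div_eq_zero_iff.1 h6 with h7 | h7
  · exact pow_eq_zero_iff two_ne_zero |>.1 h7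
  · exact absurd h7 (by positivity)

/-- The excess risk over the span equals the squared `L₂` distance to the oracle. -/
lemma eLpNorm_sub_sq_eq_excess_risk (hX : HasLaw X μ P₀) (hF : ∀ j, MemLp (F j) 2 μ)
    (hζ : MemLp (fun ω => Y ω - fstar (X ω)) 2 P₀) (hstar : IsOracle P₀ X Y F fstar)
    {f : 𝒳 → ℝ} (hf : f ∈ dictSpan F) :
    (eLpNorm (f - fstar) 2 μ).toReal ^ 2 =
      risk P₀ X Y f - sInf (risk P₀ X Y '' (dictSpan F)) := by
  have hmin : IsLeast (risk P₀ X Y '' (dictSpan F)) (risk P₀ X Y fstar) := by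
    refine ⟨⟨fstar, hstar.1, rfl⟩, ?_⟩
    rintro _ ⟨g, hg, rfl⟩
    exact hstar.2 g hg
  have hd : f - fstar ∈ dictSpan F := Submodule.sub_mem _ hf hstar.1
  have h1 := risk_add_smul hX hF hζ hd 1
  rw [one_smul, add_sub_cancel, integral_oracle_residual_mul hX hF hζ hstar hd] at h1
  have hm := (memLp_of_mem_dictSpan hF hd).aestronglyMeasurable
  have h2 := toReal_eLpNorm_pow hm (n := 2) (by norm_num) (by decide)
  have h3 : ∫ ω, (f - fstar) (X ω) ^ 2 ∂P₀ = ∫ x, (f - fstar) x ^ 2 ∂μ :=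
    hX.integral_comp (f := fun x => (f - fstar) x ^ 2) (hm.pow 2)
  rw [hmin.csInf_eq, h1, h3]
  norm_num at h2 ⊢
  exact h2

end Risk

/-! ### From the two probabilistic bounds to the estimation error. -/

/-- The basic inequality for an empirical risk minimiser. -/
lemma IsERM.sum_sq_le {𝒳 : Type*} {N M : ℕ} (hN : 0 < N) {x : Fin N → 𝒳} {y : Fin N → ℝ}
    {F : Fin M → 𝒳 → ℝ} {f g : 𝒳 → ℝ} (hf : IsERM x y F f) (hg : g ∈ dictSpan F) :
    ∑ i, (f - g) (x i) ^ 2 ≤ 2 * ∑ i, (y i - g (x i)) * (f - g) (x i) := by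
  have h1 := hf.2 g hg
  unfold empiricalRisk at h1
  have hN' : (0 : ℝ) < N := by exact_mod_cast hN
  have h2 := le_of_mul_le_mul_left h1 (by positivity)
  have h3 : ∑ i, (y i - f (x i)) ^ 2 = ∑ i, (y i - g (x i)) ^ 2 -
      2 * ∑ i, (y i - g (x i)) * (f - g) (x i) + ∑ i, (f - g) (x i) ^ 2 := by
    rw [Finset.mul_sum, ← Finset.sum_sub_distrib, ← Finset.sum_add_distrib]
    exact Finset.sum_congr rfl fun i _ => by simp only [Pi.sub_apply]; ring
  linarith

/-- Cauchy–Schwarz for `f²` and `g²`. It controls the noise times a basis function even when the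
noise depends on `X`. -/
lemma integral_sq_mul_sq_le {Ω : Type*} [MeasurableSpace Ω] {P : Measure Ω}
    [IsProbabilityMeasure P] {f g : Ω → ℝ} (hf : MemLp f 4 P) (hg : MemLp g 4 P) {B : ℝ}
    (hgB : ∫ ω, g ω ^ 4 ∂P ≤ B ^ 4) :
    MemLp (fun ω => f ω * g ω) 2 P ∧
      ∫ ω, (f ω * g ω) ^ 2 ∂P ≤ ((∫ ω, f ω ^ 4 ∂P) ^ (1 / 4 : ℝ)) ^ 2 * B ^ 2 := by
  have sq2 : ∀ {u : Ω → ℝ}, MemLp u 4 P → MemLp (fun ω => u ω ^ 2) 2 P := by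
    intro u hu
    refine (memLp_two_iff_integrable_sq (f := fun ω => u ω ^ 2)
      (hu.aestronglyMeasurable.pow 2)).2 ?_
    refine (integrable_pow_four hu).congr (Filter.Eventually.of_forall fun ω => ?_)
    simp only
    ring
  have hm : AEStronglyMeasurable (fun ω => f ω * g ω) P :=
    hf.aestronglyMeasurable.mul hg.aestronglyMeasurable
  refine ⟨?_, ?_⟩
  · rw [memLp_two_iff_integrable_sq hm]
    refine ((sq2 hf).integrable_mul (sq2 hg)).congr (Filter.Eventually.of_forall fun ω => ?_)
    simp only [Pi.mul_apply]
    ring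
  · have h := integral_mul_le_Lp_mul_Lq_of_nonneg (μ := P) Real.HolderConjugate.two_two
      (f := fun ω => f ω ^ 2) (g := fun ω => g ω ^ 2)
      (Filter.Eventually.of_forall fun ω => sq_nonneg _)
      (Filter.Eventually.of_forall fun ω => sq_nonneg _)
      (by simpa using sq2 hf) (by simpa using sq2 hg)
    simp only [Real.rpow_two, ← pow_mul] at h
    norm_num at h
    have hf0 : 0 ≤ ∫ ω, f ω ^ 4 ∂P := integral_nonneg fun ω => by positivity
    have e1 : ((∫ ω, f ω ^ 4 ∂P) ^ (1 / 4 : ℝ)) ^ 2 = (∫ ω, f ω ^ 4 ∂P) ^ (1 / 2 : ℝ) := by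
      rw [← Real.rpow_natCast, ← Real.rpow_mul hf0]
      norm_num
    have e2 : (∫ ω, g ω ^ 4 ∂P) ^ (1 / 2 : ℝ) ≤ B ^ 2 := by
      rw [← Real.sqrt_eq_rpow]
      refine Real.sqrt_le_iff.2 ⟨by positivity, hgB.trans (le_of_eq (by ring))⟩
    simp only [mul_pow]
    rw [e1]
    exact h.trans (mul_le_mul_of_nonneg_left e2 (by positivity))

/-- The failure sets need not be measurable (one is a union over all `t`), so the event is the
complement of a measurable hull of their union. -/
lemma exists_measurableSet_forall {Ω : Type*} [MeasurableSpace Ω] {P : Measure Ω}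
    [IsProbabilityMeasure P] {p q r : Ω → Prop} {α β : ℝ} (hp : ∀ᵐ ω ∂P, p ω)
    (hq : P.real {ω | ¬ q ω} ≤ α) (hr : P.real {ω | ¬ r ω} ≤ β) :
    ∃ A : Set Ω, MeasurableSet A ∧ 1 - α - β ≤ P.real A ∧ ∀ ω ∈ A, p ω ∧ q ω ∧ r ω := by
  set B : Set Ω := {ω | ¬ p ω} ∪ ({ω | ¬ q ω} ∪ {ω | ¬ r ω}) with hB
  have hBle : P.real B ≤ α + β := by
    have h1 : P.real {ω | ¬ p ω} = 0 := by
      rw [measureReal_eq_zero_iff]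
      exact ae_iff.1 hp
    have h2 := measureReal_union_le (μ := P) {ω | ¬ p ω} ({ω | ¬ q ω} ∪ {ω | ¬ r ω})
    have h3 := measureReal_union_le (μ := P) {ω | ¬ q ω} {ω | ¬ r ω}
    linarith
  refine ⟨(toMeasurable P B)ᶜ, (measurableSet_toMeasurable P B).compl, ?_, fun ω hω => ?_⟩
  · rw [probReal_compl_eq_one_sub (measurableSet_toMeasurable P B), measureReal_def,
      measure_toMeasurable, ← measureReal_def]
    linarith
  · have h1 : ω ∉ B := fun h => hω (subset_toMeasurable P B h)
    simp only [hB, Set.mem_union, Set.mem_ofPred_eq, not_or, not_not] at h1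
    exact h1

/-- From the lower bound on the quadratic process and the bound on the noise to the error. -/
lemma dotProduct_self_le_of_basic_inequality {N d : ℕ} (hN : 0 < N) {t Z : Fin d → ℝ} {Q C : ℝ}
    (h1 : N / 8 * (t ⬝ᵥ t) ≤ Q) (h2 : Q ≤ 2 * (t ⬝ᵥ Z)) (h3 : ∑ k, Z k ^ 2 ≤ N * C) :
    t ⬝ᵥ t ≤ 256 * (C / N) := by
  have hN' : (0 : ℝ) < N := by exact_mod_cast hN
  have hcs : (t ⬝ᵥ Z) ^ 2 ≤ (t ⬝ᵥ t) * ∑ k, Z k ^ 2 := by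
    have := Finset.sum_mul_sq_le_sq_mul_sq Finset.univ t Z
    simpa [dotProduct, sq] using this
  have hZ0 : 0 ≤ ∑ k, Z k ^ 2 := Finset.sum_nonneg fun k _ => sq_nonneg _
  have ht0 : 0 ≤ t ⬝ᵥ t := Finset.sum_nonneg fun k _ => mul_self_nonneg _
  have hC : 0 ≤ C := nonneg_of_mul_nonneg_right (hZ0.trans h3) hN'
  rcases ht0.eq_or_lt with ht | ht
  · rw [← ht]; positivity
  have h4 : N * (t ⬝ᵥ t) ≤ 16 * (t ⬝ᵥ Z) := by linarith
  have h5 : (N * (t ⬝ᵥ t)) ^ 2 ≤ (16 * (t ⬝ᵥ Z)) ^ 2 :=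
    pow_le_pow_left₀ (by positivity) h4 2
  have h6 : (t ⬝ᵥ t) * ∑ k, Z k ^ 2 ≤ (t ⬝ᵥ t) * (N * C) := mul_le_mul_of_nonneg_left h3 ht0
  have h7 : (N * (t ⬝ᵥ t)) * (N * (t ⬝ᵥ t)) ≤ (N * (t ⬝ᵥ t)) * (256 * C) := by nlinarith
  have h8 := le_of_mul_le_mul_left h7 (by positivity)
  rw [← mul_div_assoc, le_div_iff₀ hN']
  linarith

/-- The estimation error of empirical risk minimisation, in an orthonormal system spanning the
dictionary. -/
lemma exists_event_eLpNorm_sub_sq_le {𝒳 Ω₀ Ω : Type*} [MeasurableSpace 𝒳] {μ : Measure 𝒳}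
    [IsProbabilityMeasure μ] [MeasurableSpace Ω₀] {P₀ : Measure Ω₀} [IsProbabilityMeasure P₀]
    {X : Ω₀ → 𝒳} {Y : Ω₀ → ℝ} (hX : HasLaw X μ P₀)
    {M : ℕ} {F : Fin M → 𝒳 → ℝ} (hF : ∀ j, MemLp (F j) 2 μ) {θ : ℝ} (hθ : 0 < θ)
    (hnorm : ∀ f ∈ dictSpan F, eLpNorm f 4 μ ≤ ENNReal.ofReal θ * eLpNorm f 2 μ)
    {fstar : 𝒳 → ℝ} (hstar : IsOracle P₀ X Y F fstar)
    (hζ : MemLp (fun ω => Y ω - fstar (X ω)) 4 P₀)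
    {N : ℕ} (hN : 0 < N) (hNM : (100 * θ ^ 4) ^ 2 * (M : ℝ) ≤ N)
    [MeasurableSpace Ω] {P : Measure Ω} [IsProbabilityMeasure P]
    {Xs : Fin N → Ω → 𝒳} {Ys : Fin N → Ω → ℝ}
    (hind : iIndepFun (fun i ω => (Xs i ω, Ys i ω)) P)
    (hid : ∀ i, IdentDistrib (fun ω => (Xs i ω, Ys i ω)) (fun ω => (X ω, Y ω)) P P₀)
    {fhat : Ω → 𝒳 → ℝ} (hfhat : ∀ ω, IsERM (fun i => Xs i ω) (fun i => Ys i ω) F (fhat ω))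
    {x : ℝ} (hx : 0 < x) :
    ∃ A : Set Ω, MeasurableSet A ∧
      1 - Real.exp (-((N : ℝ) / (64 * θ ^ 8))) - 1 / x ≤ P.real A ∧
      ∀ ω ∈ A, (eLpNorm (fhat ω - fstar) 2 μ).toReal ^ 2 ≤ 256 * θ ^ 12 *
        (((∫ ω, (Y ω - fstar (X ω)) ^ 4 ∂P₀) ^ (1 / 4 : ℝ)) ^ 2 * (M : ℝ) * x / (N : ℝ)) := by
  set σ : ℝ := (∫ ω, (Y ω - fstar (X ω)) ^ 4 ∂P₀) ^ (1 / 4 : ℝ) with hσ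
  have hN' : (0 : ℝ) < N := by exact_mod_cast hN
  obtain ⟨d, hdM, e, hem, heL, heo, hFe, he⟩ := exists_orthonormal_dictSpan μ F hF
  set E : 𝒳 → Fin d → ℝ := fun x k => e k x with hE
  have hEm : Measurable E := measurable_pi_lambda _ hem
  choose a ha using hFe
  -- One null set, fixed by the dictionary alone, serves the whole span; this is what permits a
  -- data-dependent `fhat ω`.
  have hgood : ∀ᵐ x ∂μ, ∀ j, F j x = a j ⬝ᵥ E x := ae_all_iff.2 ha
  have hnormsq : ∀ {f : 𝒳 → ℝ} {t : Fin d → ℝ}, (∀ x, (∀ j, F j x = a j ⬝ᵥ E x) → f x = t ⬝ᵥ E x) →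
      (eLpNorm f 2 μ).toReal ^ 2 = t ⬝ᵥ t := by
    intro f t hft
    have h1 : f =ᵐ[μ] fun x => t ⬝ᵥ E x := hgood.mono hft
    rw [eLpNorm_congr_ae h1, ← integral_dotProduct_sq heL heo t]
    refine toReal_eLpNorm_pow (n := 2) ?_ (by norm_num) (by decide)
    exact ((measurable_dotProduct_left t).comp hEm).aestronglyMeasurable
  -- For `d = 0` the error vanishes; `θ ≥ 1` is only available when some basis function exists.
  rcases Nat.eq_zero_or_pos d with hd | hd
  · subst hd
    refine ⟨Set.univ, MeasurableSet.univ, ?_, fun ω _ => ?_⟩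
    · rw [probReal_univ]
      have := Real.exp_pos (-((N : ℝ) / (64 * θ ^ 8)))
      have : 0 < 1 / x := by positivity
      linarith
    · obtain ⟨t, ht⟩ := exists_coeff_of_mem_dictSpan (e := E) a
        (Submodule.sub_mem _ (hfhat ω).1 hstar.1)
      rw [hnormsq ht]
      have : t ⬝ᵥ t = 0 := by simp [dotProduct]
      rw [this]
      positivity
  have hE4 := memLp_four_and_integral_le heL heo he hθ hnorm
  have hek : ∀ k x, Pi.single k (1 : ℝ) ⬝ᵥ E x = e k x := fun k x => by simp [hE]
  have he4 : ∀ k, MemLp (e k) 4 μ ∧ ∫ x, e k x ^ 4 ∂μ ≤ θ ^ 4 := by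
    intro k
    have := hE4 (Pi.single k 1)
    change MemLp (fun x => _ ⬝ᵥ E x) 4 μ ∧ ∫ x, (_ ⬝ᵥ E x) ^ 4 ∂μ ≤ _ at this
    simpa [hek] using this
  -- A unit vector `e k` satisfies `1 ≤ ∫ e k ^ 4 ≤ θ ^ 4`, since `e² ≤ (1 + e⁴) / 2`.
  have hθ1 : 1 ≤ θ := by
    set k : Fin d := ⟨0, hd⟩
    have h1 : ∫ x, e k x ^ 2 ∂μ = 1 := by simpa [sq] using heo k k
    have h2 : ∫ x, e k x ^ 2 ∂μ ≤ ∫ x, (1 + e k x ^ 4) / 2 ∂μ := by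
      refine integral_mono (heL k).integrable_sq
        (((integrable_const 1).add (integrable_pow_four (he4 k).1)).div_const 2) fun x => ?_
      simp only
      nlinarith [sq_nonneg (e k x ^ 2 - 1)]
    rw [integral_div, integral_add (integrable_const 1) (integrable_pow_four (he4 k).1)] at h2
    simp only [integral_const, probReal_univ, one_smul] at h2
    have h3 : 1 ≤ θ ^ 4 := by linarith [(he4 k).2]
    by_contra! h
    exact h3.not_gt (pow_lt_one₀ hθ.le h (by norm_num))
  have hdM' : (d : ℝ) ≤ M := by exact_mod_cast hdM
  have hXs : ∀ i, HasLaw (Xs i) μ P := fun i =>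
    ⟨measurable_fst.comp_aemeasurable (hid i).aemeasurable_fst,
      ((hid i).comp measurable_fst).map_eq.trans hX.map_eq⟩
  obtain ⟨ts, hts⟩ := exists_coeff_of_mem_dictSpan (e := E) a hstar.1
  -- The noise vectors.
  set w : 𝒳 × ℝ → Fin d → ℝ := fun z k => (z.2 - ts ⬝ᵥ E z.1) * e k z.1 with hw
  -- Using `ts ⬝ᵥ E` in place of `fstar`, which may be only a.e. measurable, makes `w` measurable.
  have hwm : Measurable w := by
    refine measurable_pi_lambda _ fun k => Measurable.mul ?_ ((hem k).comp measurable_fst)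
    exact measurable_snd.sub ((measurable_dotProduct_left ts).comp (hEm.comp measurable_fst))
  have hwX : ∀ k, (fun ω => w (X ω, Y ω) k) =ᵐ[P₀]
      fun ω => (Y ω - fstar (X ω)) * e k (X ω) := by
    intro k
    have h1 : ∀ᵐ ω ∂P₀, ∀ j, F j (X ω) = a j ⬝ᵥ E (X ω) :=
      ae_of_ae_map hX.aemeasurable (by rw [hX.map_eq]; exact hgood)
    filter_upwards [h1] with ω hω
    simp only [hw, hts _ hω]
  have heX : ∀ k, MemLp (fun ω => e k (X ω)) 4 P₀ ∧ ∫ ω, e k (X ω) ^ 4 ∂P₀ ≤ θ ^ 4 := by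
    intro k
    refine ⟨memLp_comp_of_hasLaw hX (he4 k).1, ?_⟩
    have := hX.integral_comp (f := fun x => e k x ^ 4)
      ((hem k).pow_const 4).aestronglyMeasurable
    exact (le_of_eq this).trans (he4 k).2
  have hprod := fun k => integral_sq_mul_sq_le hζ (heX k).1 (heX k).2
  have hwid : ∀ i k, IdentDistrib (fun ω => w (Xs i ω, Ys i ω) k) (fun ω => w (X ω, Y ω) k) P P₀ :=
    fun i k => (hid i).comp ((measurable_pi_apply k).comp hwm)
  have hwL : ∀ i k, MemLp (fun ω => w (Xs i ω, Ys i ω) k) 2 P := fun i k =>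
    (hwid i k).memLp_iff.2 ((memLp_congr_ae (hwX k)).2 (hprod k).1)
  have hζ2 : MemLp (fun ω => Y ω - fstar (X ω)) 2 P₀ := hζ.mono_exponent (by norm_num)
  have hw0 : ∀ i k, ∫ ω, w (Xs i ω, Ys i ω) k ∂P = 0 := by
    intro i k
    rw [(hwid i k).integral_eq, integral_congr_ae (hwX k)]
    obtain ⟨f, hf, hfe⟩ := he k
    rw [← integral_oracle_residual_mul hX hF hζ2 hstar hf]
    have h1 : ∀ᵐ ω ∂P₀, f (X ω) = e k (X ω) :=
      ae_of_ae_map hX.aemeasurable (by rw [hX.map_eq]; exact hfe)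
    refine integral_congr_ae ?_
    filter_upwards [h1] with ω hω
    simp only [hω]
  have hw2 : ∀ i k, ∫ ω, w (Xs i ω, Ys i ω) k ^ 2 ∂P ≤ σ ^ 2 * θ ^ 2 := by
    intro i k
    have h1 := ((hwid i k).comp (measurable_id.pow_const 2)).integral_eq
    refine le_trans (le_of_eq (h1.trans ?_)) (hprod k).2
    refine integral_congr_ae ?_
    filter_upwards [hwX k] with ω hω
    simp only [Function.comp, id, hω]
  have hnoise := measure_sum_sq_gt_le (W := fun i ω => w (Xs i ω, Ys i ω)) (hind.comp (fun _ => w) fun _ => hwm) hwL hw0 hw2 hx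
  -- The quadratic process.
  have hL : ∀ i, ∀ u : Fin d → ℝ, MemLp (fun ω => u ⬝ᵥ E (Xs i ω)) 4 P := fun i u =>
    memLp_comp_of_hasLaw (hXs i) (hE4 u).1
  have hquad := measure_exists_quadratic_lt_le (P := P) hd hθ1 (N := N)
    (x := fun i ω => E (Xs i ω))
    (by
      refine le_trans ?_ hNM
      have : 10000 * θ ^ 8 * (d : ℝ) ≤ 10000 * θ ^ 8 * M := by gcongr
      refine this.trans (le_of_eq (by ring)))
    (hind.comp (fun _ z => E z.1) fun _ => hEm.comp measurable_fst)
    (fun i => hEm.comp_aemeasurable (hXs i).aemeasurable) hL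
    (fun i u => by
      rw [← integral_dotProduct_sq heL heo u]
      exact (hXs i).integral_comp (f := fun x => (u ⬝ᵥ E x) ^ 2)
        (((measurable_dotProduct_left u).comp hEm).pow_const 2).aestronglyMeasurable)
    (fun i u => by
      refine le_trans (le_of_eq ?_) (hE4 u).2
      exact (hXs i).integral_comp (f := fun x => (u ⬝ᵥ E x) ^ 4)
        (((measurable_dotProduct_left u).comp hEm).pow_const 4).aestronglyMeasurable)
  have hsample : ∀ᵐ ω ∂P, ∀ i j, F j (Xs i ω) = a j ⬝ᵥ E (Xs i ω) :=
    ae_all_iff.2 fun i => ae_of_ae_map (hXs i).aemeasurable (by rw [(hXs i).map_eq]; exact hgood)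
  obtain ⟨A, hA, hPA, hAω⟩ := exists_measurableSet_forall (P := P) hsample
    (q := fun ω => ∀ t : Fin d → ℝ, N / 8 * (t ⬝ᵥ t) ≤ ∑ i, (t ⬝ᵥ E (Xs i ω)) ^ 2)
    (r := fun ω => ∑ k, (∑ i, w (Xs i ω, Ys i ω) k) ^ 2 ≤ N * d * (σ ^ 2 * θ ^ 2) * x)
    (by simpa only [not_forall, not_le] using hquad)
    (by simpa only [not_le] using hnoise)
  refine ⟨A, hA, hPA, fun ω hω => ?_⟩
  obtain ⟨hs, hq, hr⟩ := hAω ω hω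
  obtain ⟨t, ht⟩ := exists_coeff_of_mem_dictSpan (e := E) a
    (Submodule.sub_mem _ (hfhat ω).1 hstar.1)
  rw [hnormsq ht]
  have hbasic := (hfhat ω).sum_sq_le hN hstar.1
  have e1 : ∑ i, (fhat ω - fstar) (Xs i ω) ^ 2 = ∑ i, (t ⬝ᵥ E (Xs i ω)) ^ 2 :=
    Finset.sum_congr rfl fun i _ => by rw [ht _ (hs i)]
  have e2 : ∑ i, (Ys i ω - fstar (Xs i ω)) * (fhat ω - fstar) (Xs i ω) =
      t ⬝ᵥ fun k => ∑ i, w (Xs i ω, Ys i ω) k := by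
    simp only [dotProduct, Finset.mul_sum]
    rw [Finset.sum_comm]
    refine Finset.sum_congr rfl fun i _ => ?_
    rw [ht _ (hs i), hts _ (hs i)]
    nth_rw 2 [dotProduct]
    rw [Finset.mul_sum]
    refine Finset.sum_congr rfl fun k _ => ?_
    simp only [hw, hE]
    ring
  rw [e1, e2] at hbasic
  refine (dotProduct_self_le_of_basic_inequality hN (hq t) hbasic
    (C := d * (σ ^ 2 * θ ^ 2) * x) (by linarith)).trans ?_
  -- The argument yields the factor `θ²`; it is weakened to `θ¹²` here.
  have hθ12 : θ ^ 2 ≤ θ ^ 12 := pow_le_pow_right₀ hθ1 (by norm_num)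
  calc 256 * (d * (σ ^ 2 * θ ^ 2) * x / N) ≤ 256 * (M * (σ ^ 2 * θ ^ 12) * x / N) := by gcongr
    _ = _ := by ring

end LinearAggregation

theorem mainTheorem3 :
    ∃ c₀ c₁ c₂ : ℝ, 0 < c₀ ∧ 0 < c₁ ∧ 0 < c₂ ∧
      ∀ (𝒳 : Type*) [MeasurableSpace 𝒳] (μ : Measure 𝒳) [IsProbabilityMeasure μ]
        -- the generic couple `(X, Y)`, with `X` distributed according to `μ`
        (Ω₀ : Type*) [MeasurableSpace Ω₀] (P₀ : Measure Ω₀) [IsProbabilityMeasure P₀]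
        (X : Ω₀ → 𝒳) (Y : Ω₀ → ℝ) (_ : HasLaw X μ P₀) (_ : MemLp Y 2 P₀)
        -- the dictionary, the norm equivalence on its span, and the oracle
        (M : ℕ) (F : Fin M → 𝒳 → ℝ) (_ : ∀ j, MemLp (F j) 2 μ)
        (θ₀ : ℝ) (_ : 0 < θ₀)
        (_ : ∀ f ∈ LinearAggregation.dictSpan F,
          eLpNorm f 4 μ ≤ ENNReal.ofReal θ₀ * eLpNorm f 2 μ)
        (fstar : 𝒳 → ℝ) (_ : LinearAggregation.IsOracle P₀ X Y F fstar)
        -- the noise `ζ = Y - f*(X)` and `σ = (𝔼 ζ⁴)^{1/4}`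
        (ζ : Ω₀ → ℝ) (_ : ζ = fun ω => Y ω - fstar (X ω)) (_ : MemLp ζ 4 P₀)
        (σ : ℝ) (_ : σ = (∫ ω, ζ ω ^ 4 ∂P₀) ^ (1 / 4 : ℝ))
        -- the sample: `N` independent copies of `(X, Y)`
        (N : ℕ) (_ : 0 < N) (_ : (c₀ * θ₀ ^ 4) ^ 2 * (M : ℝ) ≤ (N : ℝ))
        (Ω : Type*) [MeasurableSpace Ω] (P : Measure Ω) [IsProbabilityMeasure P]
        (Xs : Fin N → Ω → 𝒳) (Ys : Fin N → Ω → ℝ)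
        (_ : iIndepFun (fun i ω => (Xs i ω, Ys i ω)) P)
        (_ : ∀ i, IdentDistrib (fun ω => (Xs i ω, Ys i ω)) (fun ω => (X ω, Y ω)) P P₀)
        -- any choice, measurable or not, of an empirical risk minimiser for every sample
        (fhat : Ω → 𝒳 → ℝ)
        (_ : ∀ ω, LinearAggregation.IsERM (fun i => Xs i ω) (fun i => Ys i ω) F (fhat ω))
        (x : ℝ) (_ : 0 < x),
        ∃ A : Set Ω, MeasurableSet A ∧
          1 - Real.exp (-((N : ℝ) / (c₁ * θ₀ ^ 8))) - 1 / x ≤ P.real A ∧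
          ∀ ω ∈ A,
            (eLpNorm (fhat ω - fstar) 2 μ).toReal ^ 2 =
                LinearAggregation.risk P₀ X Y (fhat ω) -
                  sInf (LinearAggregation.risk P₀ X Y '' (LinearAggregation.dictSpan F)) ∧
            (eLpNorm (fhat ω - fstar) 2 μ).toReal ^ 2 ≤
              c₂ * θ₀ ^ 12 * (σ ^ 2 * (M : ℝ) * x / (N : ℝ)) := by
  -- `100² = 10000` pays for the union bound, `64` is left in the exponent after it, and `256 = (2 ·
  -- 8)²` comes from the factor `2` in the basic inequality and the lower bound `N/8`.
  refine ⟨100, 64, 256, by norm_num, by norm_num, by norm_num, ?_⟩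
  intro 𝒳 _ μ _ Ω₀ _ P₀ _ X Y hX _ M F hF θ₀ hθ hnorm fstar hstar ζ hζdef hζ σ hσ N hN hNM
    Ω _ P _ Xs Ys hind hid fhat hfhat x hx
  subst hζdef
  obtain ⟨A, hA, hPA, hAω⟩ := LinearAggregation.exists_event_eLpNorm_sub_sq_le hX hF hθ hnorm
    hstar hζ hN hNM hind hid hfhat hx
  refine ⟨A, hA, hPA, fun ω hω => ⟨?_, ?_⟩⟩
  · exact LinearAggregation.eLpNorm_sub_sq_eq_excess_risk hX hF
      (hζ.mono_exponent (by norm_num)) hstar (hfhat ω).1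
  · rw [hσ]
    exact hAω ω hω
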